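/- For a vector $v$ write $\|v\|_1=\sum_i|v_i|$. For real numbers $c_1,c_2>0$, a real matrix $T$ with $n$ columns is called an $\ell_1$-subspace embedding with exponents $c_1,c_2$ for a matrix $A\in\mathbb{R}^{n\times d}$ if $T$ has at most $d^{c_2}$ rows and $\|Ax\|_1\le\|TAx\|_1\le d^{c_1}\|Ax\|_1$ for all $x\in\mathbb{R}^d$. Theorem. There is an absolute constant $c>0$ such that for every $C\ge c$ there are constants $K,c_1,c_2>0$, depending only on $C$, with the following property. Let $d\ge 2$, $n\ge 0$ and $r$ be integers with $$c\,d\log d\;\le\; r\;\le\; C\,d\log d,$$ let $A$ be any real $n\times d$ matrix, and let $S$ be a random $r\times n$ matrix whose entries are independent standard Cauchy random variables (density $\frac1\pi\cdot\frac1{1+t^2}$). Then with probability at least $9/10$, the matrix $\frac4r S$ is an $\ell_1$-subspace embedding with exponents $c_1,c_2$ for $A$ and, more precisely, simultaneously for all $x\in\mathbb{R}^d$, $$\|Ax\|_1\;\le\;\frac{4\,\|SAx\|_1}{r}\;\le\; K\,d\log d\;\|Ax\|_1 .$$ -/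

import Mathlib

open MeasureTheory ProbabilityTheory
open scoped Matrix ENNReal

/-- The `ℓ₁`-norm `∑ i, |v i|` of a real vector: Mathlib's norm on `PiLp 1`. -/
noncomputable def l1Norm {m : ℕ} (v : Fin m → ℝ) : ℝ :=
  ‖WithLp.toLp 1 v‖

theorem l1Norm_eq_sum {m : ℕ} (v : Fin m → ℝ) : l1Norm v = ∑ i, |v i| := by
  simp [l1Norm, PiLp.norm_eq_of_L1]

/-- `S` is a random `r × n` matrix whose entries are independent standard Cauchy random variables
(density `1 / (π (1 + t ^ 2))`). -/
structure IsCauchyMatrix {Ω : Type*} [MeasurableSpace Ω] (μ : Measure Ω) {r n : ℕ}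
    (S : Ω → Matrix (Fin r) (Fin n) ℝ) : Prop where
  hasLaw : ∀ i j, HasLaw (fun ω => S ω i j) (cauchyMeasure 0 1) μ
  indep : iIndepFun (fun (p : Fin r × Fin n) ω => S ω p.1 p.2) μ

/-- `T` is an `ℓ₁`-subspace embedding for the `n × d` matrix `A`, with exponents `c₁` and `c₂`:
`‖A x‖₁ ≤ ‖T A x‖₁ ≤ d ^ c₁ ‖A x‖₁` for all `x`, and `T` has at most `d ^ c₂` rows. -/
def IsL1SubspaceEmbedding (c₁ c₂ : ℝ) {r n d : ℕ}
    (T : Matrix (Fin r) (Fin n) ℝ) (A : Matrix (Fin n) (Fin d) ℝ) : Prop :=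
  (∀ x : Fin d → ℝ,
    l1Norm (A *ᵥ x) ≤ l1Norm ((T * A) *ᵥ x) ∧
      l1Norm ((T * A) *ᵥ x) ≤ (d : ℝ) ^ c₁ * l1Norm (A *ᵥ x)) ∧
  (r : ℝ) ≤ (d : ℝ) ^ c₂

/-! The Cauchy law is 1-stable: for fixed `y` the coordinates of `S y` are independent Cauchy
variables scaled by `‖y‖₁`. Heavy tails only help a lower bound, so Chernoff applied to `exp (-|X|)`
gives `‖S y‖₁ ≥ (3/10) r ‖y‖₁` except with probability `exp (-r/20)`.

An upper bound cannot be union-bounded, since Cauchy tails decay only like `1/M`. Instead, take an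
Auerbach basis `U` of the column space: columns of norm 1, coordinates bounded by the norm. The
entries of `S U` are at most `r d` Cauchy variables, and truncation with Markov bounds the sum of
their absolute values by `B = O(r d log (r d))` with probability 19/20. Then `‖S U a‖₁ ≤ B max |a j|
≤ B ‖U a‖₁` for all `a` at once.

The same `B` controls the error of rounding `a` to an integer grid, so the lower bound passes from
the grid to every vector. The grid has side polynomial in `r`, so its log-cardinality is `O(d log
r)`, which `r/20` dominates once `r ≥ c d log d` with `c` large. -/

/-! ### The standard Cauchy law: characteristic function, tails, truncated moments. -/

open scoped FourierTransform in
theorem charFun_cauchyMeasure (t : ℝ) :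
    charFun (cauchyMeasure 0 1) t = Complex.exp (-|t| : ℝ) := by
  -- The Fourier transform of `f` is the Cauchy density, by integrating over the two half-lines;
  -- inversion at `t / (2π)` then gives the claim.
  set f : ℝ → ℂ := fun x => Complex.exp (-(2 * Real.pi * |x|) : ℝ) with hf
  have hcont : Continuous f := by fun_prop
  have hpi := Real.pi_pos
  have hneg : ∀ w : ℝ, (-(2 * Real.pi) - 2 * Real.pi * w * Complex.I : ℂ).re < 0 := by
    intro w; simp [hpi]
  have hpos : ∀ w : ℝ, 0 < (2 * Real.pi - 2 * Real.pi * w * Complex.I : ℂ).re := by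
    intro w; simp [hpi]
  have hIoi : ∀ w : ℝ, Set.EqOn (fun x : ℝ => Complex.exp ((-(2 * Real.pi) - 2 * Real.pi * w * Complex.I : ℂ) * x))
      (fun x : ℝ => Complex.exp (↑(-2 * Real.pi * x * w) * Complex.I) • f x) (Set.Ioi 0) := by
    intro w x hx
    simp only [hf, smul_eq_mul, ← Complex.exp_add, abs_of_pos (Set.mem_Ioi.1 hx)]
    congr 1; push_cast; ring
  have hIic : ∀ w : ℝ, Set.EqOn (fun x : ℝ => Complex.exp ((2 * Real.pi - 2 * Real.pi * w * Complex.I : ℂ) * x))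
      (fun x : ℝ => Complex.exp (↑(-2 * Real.pi * x * w) * Complex.I) • f x) (Set.Iic 0) := by
    intro w x hx
    simp only [hf, smul_eq_mul, ← Complex.exp_add, abs_of_nonpos (Set.mem_Iic.1 hx)]
    congr 1; push_cast; ring
  have iIoi : ∀ w : ℝ, IntegrableOn
      (fun x : ℝ => Complex.exp (↑(-2 * Real.pi * x * w) * Complex.I) • f x) (Set.Ioi 0) := fun w =>
    (integrableOn_exp_mul_complex_Ioi (hneg w) 0).congr_fun (hIoi w) measurableSet_Ioi
  have iIic : ∀ w : ℝ, IntegrableOn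
      (fun x : ℝ => Complex.exp (↑(-2 * Real.pi * x * w) * Complex.I) • f x) (Set.Iic 0) := fun w =>
    (integrableOn_exp_mul_complex_Iic (hpos w) 0).congr_fun (hIic w) measurableSet_Iic
  have hint : Integrable f := by
    have := (iIic 0).union (iIoi 0)
    rw [Set.Iic_union_Ioi, integrableOn_univ] at this
    simpa using this
  have hF : 𝓕 f = fun w => ((cauchyPDFReal 0 1 w : ℝ) : ℂ) := by
    ext w
    rw [Real.fourier_real_eq_integral_exp_smul, ← setIntegral_univ, ← Set.Iic_union_Ioi (a := (0 : ℝ)),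
      setIntegral_union (Set.Iic_disjoint_Ioi le_rfl) measurableSet_Ioi (iIic w) (iIoi w),
      ← setIntegral_congr_fun measurableSet_Ioi (hIoi w),
      ← setIntegral_congr_fun measurableSet_Iic (hIic w),
      integral_exp_mul_complex_Iic (hpos w), integral_exp_mul_complex_Ioi (hneg w)]
    have h1 : (2 * Real.pi - 2 * Real.pi * w * Complex.I : ℂ) ≠ 0 := fun h => by
      have := hpos w; rw [h] at this; simp at this
    have h2 : (-(2 * Real.pi) - 2 * Real.pi * w * Complex.I : ℂ) ≠ 0 := fun h => by
      have := hneg w; rw [h] at this; simp at this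
    have h3 : ((w : ℂ) ^ 2 + 1) ≠ 0 := by
      have : (0 : ℝ) < w ^ 2 + 1 := by positivity
      exact_mod_cast this.ne'
    have h4 : (Real.pi : ℂ) ≠ 0 := by exact_mod_cast hpi.ne'
    simp only [cauchyPDFReal_def, sub_zero, Complex.ofReal_zero, mul_zero, Complex.exp_zero,
      NNReal.coe_one]
    push_cast
    rw [div_add_div _ _ h1 h2, div_eq_iff (mul_ne_zero h1 h2)]
    field_simp
    ring_nf
    simp only [Complex.I_sq]
    ring
  have hFint : Integrable (𝓕 f) := by
    rw [hF]; exact (integrable_cauchyPDFReal 0).ofReal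
  have key := congrFun (hcont.fourierInv_fourier_eq hint hFint) (t / (2 * Real.pi))
  rw [charFun_apply_real, cauchyMeasure_of_scale_ne_zero 0 one_ne_zero]
  unfold cauchyPDF
  rw [integral_withDensity_eq_integral_toReal_smul (by fun_prop) (by simp)]
  rw [Real.fourierInv_eq', hF] at key
  have h5 : f (t / (2 * Real.pi)) = Complex.exp (-|t| : ℝ) := by
    simp only [hf, abs_div, abs_of_pos (show (0 : ℝ) < 2 * Real.pi by positivity)]
    congr 2; field_simp
  rw [← h5, ← key]
  refine integral_congr_ae (Filter.Eventually.of_forall fun x => ?_)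
  simp only [ENNReal.toReal_ofReal (cauchyPDF_pos 0 one_ne_zero x).le, smul_eq_mul,
    Complex.real_smul]
  rw [mul_comm]
  congr 2
  simp only [RCLike.inner_apply, conj_trivial]
  push_cast
  have h4 : (Real.pi : ℂ) ≠ 0 := by exact_mod_cast hpi.ne'
  field_simp

theorem setIntegral_cauchyMeasure {E : Type*} [NormedAddCommGroup E] [NormedSpace ℝ E]
    {s : Set ℝ} (hs : MeasurableSet s) (f : ℝ → E) :
    ∫ x in s, f x ∂(cauchyMeasure 0 1) = ∫ x in s, (Real.pi⁻¹ * (1 + x ^ 2)⁻¹) • f x := by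
  rw [cauchyMeasure_of_scale_ne_zero 0 one_ne_zero]
  unfold cauchyPDF
  rw [setIntegral_withDensity_eq_setIntegral_toReal_smul (by fun_prop) (by simp) _ hs]
  refine setIntegral_congr_fun hs fun x _ => ?_
  simp only [ENNReal.toReal_ofReal (cauchyPDF_pos 0 (one_ne_zero (α := NNReal)) x).le]
  simp [cauchyPDFReal_def, add_comm]

theorem cauchyMeasure_real_Icc {M : ℝ} (hM : 0 ≤ M) :
    (cauchyMeasure 0 1).real (Set.Icc (-M) M) = 2 * Real.arctan M / Real.pi := by
  have h := setIntegral_cauchyMeasure (measurableSet_Icc (a := -M) (b := M)) (fun _ => (1 : ℝ))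
  rw [setIntegral_const] at h
  simp only [smul_eq_mul, mul_one] at h
  rw [h, integral_Icc_eq_integral_Ioc, ← intervalIntegral.integral_of_le (by linarith),
    intervalIntegral.integral_const_mul, integral_inv_one_add_sq, Real.arctan_neg]
  ring

theorem cauchyMeasure_real_compl_Icc_le {M : ℝ} (hM : 0 < M) :
    (cauchyMeasure 0 1).real (Set.Icc (-M) M)ᶜ ≤ 1 / M := by
  rw [probReal_compl_eq_one_sub measurableSet_Icc, cauchyMeasure_real_Icc hM.le]
  have h := Real.arctan_inv_of_pos hM
  have h1 : Real.arctan M⁻¹ ≤ M⁻¹ := by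
    have h0 : (0 : ℝ) < M⁻¹ := by positivity
    have := Real.lt_tan (Real.arctan_pos.2 h0) (Real.arctan_lt_pi_div_two _)
    rw [Real.tan_arctan] at this
    exact this.le
  have h2 : Real.arctan M = Real.pi / 2 - Real.arctan M⁻¹ := by linarith
  have h3 := Real.pi_gt_three
  rw [h2, one_div]
  have : 1 - 2 * (Real.pi / 2 - Real.arctan M⁻¹) / Real.pi = (2 / Real.pi) * Real.arctan M⁻¹ := by
    field_simp; ring
  rw [this]
  have h4 : 0 ≤ Real.arctan M⁻¹ := Real.arctan_nonneg.2 (by positivity)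
  have h5 : 2 / Real.pi ≤ 1 := by rw [div_le_one (by linarith)]; linarith
  nlinarith

theorem setIntegral_abs_cauchyMeasure {M : ℝ} (hM : 0 ≤ M) :
    ∫ x in Set.Icc (-M) M, |x| ∂(cauchyMeasure 0 1) = Real.log (1 + M ^ 2) / Real.pi := by
  rw [setIntegral_cauchyMeasure measurableSet_Icc, integral_Icc_eq_integral_Ioc,
    ← intervalIntegral.integral_of_le (by linarith)]
  have hc : Continuous fun x : ℝ => (Real.pi⁻¹ * (1 + x ^ 2)⁻¹) • |x| := by
    have : ∀ x : ℝ, 1 + x ^ 2 ≠ 0 := fun x => by positivity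
    fun_prop (disch := assumption)
  have hpos : ∫ x in (0)..M, (Real.pi⁻¹ * (1 + x ^ 2)⁻¹) • |x|
      = Real.log (1 + M ^ 2) / (2 * Real.pi) := by
    rw [intervalIntegral.integral_eq_sub_of_hasDerivAt_of_le hM
      (f := fun x => Real.log (1 + x ^ 2) / (2 * Real.pi))]
    · simp
    · refine ContinuousOn.div_const (ContinuousOn.log (by fun_prop) fun x _ => ?_) _
      positivity
    · intro x hx
      have h1 : HasDerivAt (fun x : ℝ => 1 + x ^ 2) (2 * x) x := by
        simpa using (hasDerivAt_pow 2 x).const_add 1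
      have h2 := (h1.log (by positivity)).div_const (2 * Real.pi)
      have h3 : (Real.pi⁻¹ * (1 + x ^ 2)⁻¹) • |x| = 2 * x / (1 + x ^ 2) / (2 * Real.pi) := by
        rw [abs_of_pos hx.1, smul_eq_mul]
        have := Real.pi_pos
        field_simp
      rw [h3]; exact h2
    · exact hc.intervalIntegrable _ _
  have hneg : ∫ x in (-M)..0, (Real.pi⁻¹ * (1 + x ^ 2)⁻¹) • |x|
      = ∫ x in (0)..M, (Real.pi⁻¹ * (1 + x ^ 2)⁻¹) • |x| := by
    have := intervalIntegral.integral_comp_neg (a := 0) (b := M)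
      (fun x : ℝ => (Real.pi⁻¹ * (1 + x ^ 2)⁻¹) • |x|)
    simpa using this.symm
  rw [← intervalIntegral.integral_add_adjacent_intervals (hc.intervalIntegrable (-M) 0)
    (hc.intervalIntegrable 0 M), hneg, hpos]
  field_simp; ring

/-- The interval `[-1, 1]` and its complement each have mass 1/2; the integrand is at most 1 on the
first and at most `exp (-1)` on the second. -/
theorem integral_exp_neg_abs_cauchyMeasure_le :
    ∫ x, Real.exp (-|x|) ∂(cauchyMeasure 0 1) ≤ (1 + Real.exp (-1)) / 2 := by
  have hI : (cauchyMeasure 0 1).real (Set.Icc (-1) 1) = 1 / 2 := by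
    rw [cauchyMeasure_real_Icc zero_le_one, Real.arctan_one]; field_simp; norm_num
  have hI' : (cauchyMeasure 0 1).real (Set.Icc (-1) 1)ᶜ = 1 / 2 := by
    rw [probReal_compl_eq_one_sub measurableSet_Icc, hI]; norm_num
  have hint : Integrable (fun x : ℝ => Real.exp (-|x|)) (cauchyMeasure 0 1) :=
    Integrable.of_bound (by fun_prop) 1 (Filter.Eventually.of_forall fun x => by
      simp)
  rw [← integral_add_compl (measurableSet_Icc (a := (-1 : ℝ)) (b := 1)) hint]
  have h1 : ∫ x in Set.Icc (-1 : ℝ) 1, Real.exp (-|x|) ∂(cauchyMeasure 0 1)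
      ≤ ∫ x in Set.Icc (-1 : ℝ) 1, (1 : ℝ) ∂(cauchyMeasure 0 1) :=
    setIntegral_mono_on hint.integrableOn (by simp) measurableSet_Icc fun x _ => by simp
  have h2 : ∫ x in (Set.Icc (-1 : ℝ) 1)ᶜ, Real.exp (-|x|) ∂(cauchyMeasure 0 1)
      ≤ ∫ x in (Set.Icc (-1 : ℝ) 1)ᶜ, Real.exp (-1) ∂(cauchyMeasure 0 1) :=
    setIntegral_mono_on hint.integrableOn (by simp) measurableSet_Icc.compl fun x hx => by
      have : 1 < |x| := by
        by_contra h; exact hx (abs_le.1 (not_lt.1 h))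
      exact Real.exp_le_exp.2 (by linarith)
  rw [setIntegral_const] at h1 h2
  rw [hI] at h1; rw [hI'] at h2
  simp only [smul_eq_mul] at h1 h2
  linarith

/-! ### 1-stability, and tail bounds for sums of absolute values. -/

section Stability

variable {Ω : Type*} [MeasurableSpace Ω] {μ : Measure Ω}

theorem charFun_map_sum_mul_cauchy {ι : Type*} [Fintype ι] {Z : ι → Ω → ℝ}
    (hZ : ∀ p, HasLaw (Z p) (cauchyMeasure 0 1) μ) (hind : iIndepFun Z μ) (w : ι → ℝ) (t : ℝ) :
    charFun (μ.map fun ω => ∑ p, w p * Z p ω) t = Complex.exp (-(|t| * ∑ p, |w p|) : ℝ) := by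
  have hm : ∀ p, AEMeasurable (fun ω => w p * Z p ω) μ := fun p =>
    (hZ p).aemeasurable.const_mul _
  have hind' : iIndepFun (fun p ω => w p * Z p ω) μ :=
    hind.comp (fun p x => w p * x) fun p => measurable_const_mul _
  rw [hind'.charFun_map_fun_sum_eq_prod hm, Finset.prod_apply, Finset.mul_sum,
    ← Finset.sum_neg_distrib, Complex.ofReal_sum, Complex.exp_sum]
  refine Finset.prod_congr rfl fun p _ => ?_
  rw [charFun_map_mul_comp (hZ p).aemeasurable, (hZ p).map_eq, charFun_cauchyMeasure, abs_mul,
    mul_comm]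

variable [IsProbabilityMeasure μ]

theorem hasLaw_sum_mul_cauchy {ι : Type*} [Fintype ι] {Z : ι → Ω → ℝ}
    (hZ : ∀ p, HasLaw (Z p) (cauchyMeasure 0 1) μ) (hind : iIndepFun Z μ) {w : ι → ℝ}
    (hw : ∑ p, |w p| = 1) :
    HasLaw (fun ω => ∑ p, w p * Z p ω) (cauchyMeasure 0 1) μ := by
  have hm : AEMeasurable (fun ω => ∑ p, w p * Z p ω) μ :=
    Finset.aemeasurable_fun_sum _ fun p _ => (hZ p).aemeasurable.const_mul _
  refine ⟨hm, ?_⟩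
  have := Measure.isProbabilityMeasure_map (μ := μ) hm
  refine Measure.ext_of_charFun (funext fun t => ?_)
  rw [charFun_map_sum_mul_cauchy hZ hind, hw, mul_one, charFun_cauchyMeasure]

variable {r n : ℕ} {S : Ω → Matrix (Fin r) (Fin n) ℝ}

theorem IsCauchyMatrix.hasLaw_mulVec (hS : IsCauchyMatrix μ S) {y : Fin n → ℝ}
    (hy : l1Norm y = 1) (i : Fin r) :
    HasLaw (fun ω => (S ω *ᵥ y) i) (cauchyMeasure 0 1) μ := by
  have hind : iIndepFun (fun l ω => S ω i l) μ :=
    hS.indep.precomp (g := fun l => (i, l)) (Prod.mk_right_injective i)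
  have := hasLaw_sum_mul_cauchy (fun l => hS.hasLaw i l) hind (w := y) (by rw [← l1Norm_eq_sum, hy])
  simpa [Matrix.mulVec, dotProduct, mul_comm] using this

/-- The joint characteristic function at `t` is that of a single combination of all entries of `S`,
with weights `t i * y l`. Stability makes it `exp (-∑ |t i| |y l|)`, which factors over `i`. -/
theorem IsCauchyMatrix.iIndepFun_mulVec (hS : IsCauchyMatrix μ S) {y : Fin n → ℝ}
    (hy : l1Norm y = 1) : iIndepFun (fun i ω => (S ω *ᵥ y) i) μ := by
  have hm : ∀ i, AEMeasurable (fun ω => (S ω *ᵥ y) i) μ := fun i =>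
    (hS.hasLaw_mulVec hy i).aemeasurable
  rw [iIndepFun_iff_charFun_pi hm]
  intro t
  have h1 : charFun (μ.map fun ω => WithLp.toLp 2 fun i => (S ω *ᵥ y) i) t
      = charFun (μ.map fun ω => ∑ p : Fin r × Fin n, (t p.1 * y p.2) * S ω p.1 p.2) 1 := by
    have hm2 : AEMeasurable
        (fun ω => ∑ p : Fin r × Fin n, (t p.1 * y p.2) * S ω p.1 p.2) μ :=
      Finset.aemeasurable_fun_sum _ fun p _ => (hS.hasLaw p.1 p.2).aemeasurable.const_mul _
    have hm1 : AEMeasurable (fun ω => WithLp.toLp 2 fun i => (S ω *ᵥ y) i) μ :=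
      (PiLp.continuous_toLp 2 _).measurable.comp_aemeasurable (aemeasurable_pi_iff.2 hm)
    rw [charFun_apply, charFun_apply, integral_map hm1 (by fun_prop),
      integral_map hm2 (by fun_prop)]
    refine integral_congr_ae (Filter.Eventually.of_forall fun ω => ?_)
    have : inner ℝ (WithLp.toLp 2 fun i => (S ω *ᵥ y) i) t
        = ∑ p : Fin r × Fin n, (t p.1 * y p.2) * S ω p.1 p.2 := by
      simp only [PiLp.inner_apply, RCLike.inner_apply, conj_trivial, Fintype.sum_prod_type,
        Matrix.mulVec, dotProduct, Finset.mul_sum]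
      refine Finset.sum_congr rfl fun i _ => Finset.sum_congr rfl fun l _ => by ring
    simp [this]
  refine (h1.trans (charFun_map_sum_mul_cauchy (Z := fun (p : Fin r × Fin n) ω => S ω p.1 p.2)
    (fun p => hS.hasLaw p.1 p.2) hS.indep (fun p => t p.1 * y p.2) 1)).trans ?_
  have h2 : ∀ i, charFun (μ.map fun ω => (S ω *ᵥ y) i) (t i) = Complex.exp (-|t i| : ℝ) := fun i => by
    rw [(hS.hasLaw_mulVec hy i).map_eq, charFun_cauchyMeasure]
  simp only [h2]
  rw [← Complex.exp_sum, ← Complex.ofReal_sum, Fintype.sum_prod_type]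
  congr 2
  simp only [abs_mul, ← Finset.mul_sum, ← l1Norm_eq_sum, hy]
  simp

theorem exp_mul_half_le : Real.exp (3 / 10) * ((1 + Real.exp (-1)) / 2) ≤ Real.exp (-(1 / 20)) := by
  -- The margin is under one percent, so `1 + u ≤ exp u` is applied to a quarter of each exponent
  -- and raised to the fourth power.
  have h1 : Real.exp (7 / 20) ≤ (80 / 73) ^ 4 := by
    have h := Real.add_one_le_exp (-(7 / 80) : ℝ)
    have h' : Real.exp (7 / 80) ≤ 80 / 73 := by
      rw [Real.exp_neg] at h
      have h0 := Real.exp_pos (7 / 80 : ℝ)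
      have := mul_le_mul_of_nonneg_right h h0.le
      rw [inv_mul_cancel₀ h0.ne'] at this
      linarith
    calc Real.exp (7 / 20) = Real.exp (7 / 80) ^ 4 := by rw [← Real.exp_nat_mul]; norm_num
      _ ≤ _ := by gcongr
  have h2 : Real.exp (-(13 / 20)) ≤ (80 / 93) ^ 4 := by
    have h := Real.add_one_le_exp (13 / 80 : ℝ)
    have h' : Real.exp (-(13 / 80)) ≤ 80 / 93 := by
      rw [Real.exp_neg, inv_le_comm₀ (Real.exp_pos _) (by norm_num)]
      linarith
    calc Real.exp (-(13 / 20)) = Real.exp (-(13 / 80)) ^ 4 := by rw [← Real.exp_nat_mul]; norm_num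
      _ ≤ _ := by gcongr
  have h3 : Real.exp (3 / 10) = Real.exp (7 / 20) * Real.exp (-(1 / 20)) := by
    rw [← Real.exp_add]; norm_num
  have h4 : Real.exp (7 / 20) * Real.exp (-1) = Real.exp (-(13 / 20)) := by
    rw [← Real.exp_add]; norm_num
  have h5 : Real.exp (3 / 10) * ((1 + Real.exp (-1)) / 2)
      = (Real.exp (7 / 20) + Real.exp (-(13 / 20))) / 2 * Real.exp (-(1 / 20)) := by
    rw [h3, ← h4]; ring
  rw [h5]
  have h6 : (Real.exp (7 / 20) + Real.exp (-(13 / 20))) / 2 ≤ 1 := by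
    norm_num at h1 h2 ⊢; linarith
  exact mul_le_of_le_one_left (Real.exp_pos _).le h6

/-- Chernoff bound at parameter `-1`: each variable contributes a factor at most `exp (3/10) * (1 +
exp (-1)) / 2 ≤ exp (-1/20)`. -/
theorem measureReal_sum_abs_cauchy_le {X : Fin r → Ω → ℝ}
    (hX : ∀ i, HasLaw (X i) (cauchyMeasure 0 1) μ) (hind : iIndepFun X μ) :
    μ.real {ω | ∑ i, |X i ω| ≤ 3 / 10 * r} ≤ Real.exp (-(r / 20)) := by
  have hm : ∀ i, AEMeasurable (fun ω => |X i ω|) μ := fun i => (hX i).aemeasurable.abs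
  have hind' : iIndepFun (fun i ω => |X i ω|) μ := hind.comp (fun _ x => |x|) fun _ => measurable_abs
  have hI : Integrable (fun ω => Real.exp (-1 * (∑ i, fun ω => |X i ω|) ω)) μ := by
    refine Integrable.of_bound ?_ 1 (Filter.Eventually.of_forall fun ω => ?_)
    · exact (Real.measurable_exp.comp_aemeasurable
        ((Finset.aemeasurable_sum _ fun i _ => hm i).const_mul _)).aestronglyMeasurable
    · simp only [Finset.sum_apply, Real.norm_eq_abs, Real.abs_exp, Real.exp_le_one_iff]
      have : 0 ≤ ∑ i, |X i ω| := Finset.sum_nonneg fun i _ => abs_nonneg _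
      linarith
  have h := measure_le_le_exp_mul_mgf (μ := μ) (X := ∑ i, fun ω => |X i ω|) (t := -1)
    (3 / 10 * r) (by norm_num) hI
  rw [hind'.mgf_sum₀ hm] at h
  have hmgf : ∀ i, mgf (fun ω => |X i ω|) μ (-1) ≤ (1 + Real.exp (-1)) / 2 := fun i => by
    have := (hX i).integral_comp (f := fun x => Real.exp (-|x|)) (by fun_prop)
    refine le_trans (le_of_eq ?_) integral_exp_neg_abs_cauchyMeasure_le
    rw [← this]
    simp [mgf]
  have hprod : ∏ i, mgf (fun ω => |X i ω|) μ (-1) ≤ ((1 + Real.exp (-1)) / 2) ^ r := by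
    calc _ ≤ ∏ _i : Fin r, (1 + Real.exp (-1)) / 2 :=
          Finset.prod_le_prod (fun i _ => mgf_nonneg) fun i _ => hmgf i
      _ = _ := by rw [Finset.prod_const, Finset.card_univ, Fintype.card_fin]
  simp only [Finset.sum_apply] at h
  calc _ ≤ _ := h
    _ ≤ Real.exp (- -1 * (3 / 10 * r)) * ((1 + Real.exp (-1)) / 2) ^ r := by gcongr
    _ = (Real.exp (3 / 10) * ((1 + Real.exp (-1)) / 2)) ^ r := by
      rw [mul_pow, ← Real.exp_nat_mul]; congr 2; ring
    _ ≤ Real.exp (-(1 / 20)) ^ r := by gcongr; exact exp_mul_half_le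
    _ = _ := by rw [← Real.exp_nat_mul]; congr 1; ring

theorem IsCauchyMatrix.measureReal_l1Norm_mulVec_lt_le (hS : IsCauchyMatrix μ S) (y : Fin n → ℝ) :
    μ.real {ω | l1Norm (S ω *ᵥ y) < 3 / 10 * r * l1Norm y} ≤ Real.exp (-(r / 20)) := by
  rcases eq_or_ne (l1Norm y) 0 with h0 | h0
  -- The strict inequality makes the event empty when `y = 0`.
  · have : {ω | l1Norm (S ω *ᵥ y) < 3 / 10 * r * l1Norm y} = ∅ := by
      ext ω
      simp only [h0, mul_zero, Set.mem_ofPred_eq, Set.mem_empty_iff_false, iff_false, not_lt]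
      exact norm_nonneg _
    rw [this]; simp [Real.exp_nonneg]
  · have hpos : 0 < l1Norm y := lt_of_le_of_ne (norm_nonneg _) h0.symm
    set u : Fin n → ℝ := (l1Norm y)⁻¹ • y with hu
    have hu1 : l1Norm u = 1 := by
      rw [l1Norm_eq_sum, hu]
      simp only [Pi.smul_apply, smul_eq_mul, abs_mul, ← Finset.mul_sum]
      rw [← l1Norm_eq_sum, abs_of_pos (by positivity), inv_mul_cancel₀ h0]
    refine le_trans (measureReal_mono fun ω hω => ?_)
      (measureReal_sum_abs_cauchy_le (hS.hasLaw_mulVec hu1) (hS.iIndepFun_mulVec hu1))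
    simp only [Set.mem_ofPred_eq] at hω ⊢
    have h2 : ∑ i, |(S ω *ᵥ u) i| = (l1Norm y)⁻¹ * l1Norm (S ω *ᵥ y) := by
      rw [l1Norm_eq_sum (S ω *ᵥ y), hu, Matrix.mulVec_smul]
      simp only [Pi.smul_apply, smul_eq_mul, abs_mul, ← Finset.mul_sum]
      rw [abs_of_pos (by positivity : 0 < (l1Norm y)⁻¹)]
    rw [h2, inv_mul_le_iff₀ hpos]
    linarith

/-- Cauchy variables have no mean, so they are truncated at `M = 40 m`. Some variable exceeds `M`
with probability at most 1/40, and Markov applied to the truncated sum costs another 1/40.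
Independence plays no role, which matters because entries in one row of `S U` may be dependent. -/
theorem measureReal_sum_abs_cauchy_gt_le {ι : Type*} [Fintype ι] {Z : ι → Ω → ℝ}
    (hZ : ∀ p, HasLaw (Z p) (cauchyMeasure 0 1) μ) {m : ℝ} (hm : 1 ≤ m)
    (hcard : (Fintype.card ι : ℝ) ≤ m) :
    μ.real {ω | 20 * m * Real.log (1 + (40 * m) ^ 2) < ∑ p, |Z p ω|} ≤ 1 / 20 := by
  set M : ℝ := 40 * m with hM
  have hM0 : 0 < M := by positivity
  set L := Real.log (1 + M ^ 2) with hL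
  have hLpos : 0 < L := Real.log_pos (by nlinarith)
  set g : ℝ → ℝ := (Set.Icc (-M) M).indicator fun x => |x| with hg
  have hgm : Measurable g := measurable_abs.indicator measurableSet_Icc
  have hg0 : ∀ x, 0 ≤ g x := fun x => Set.indicator_nonneg (fun _ _ => abs_nonneg _) x
  have hgM : ∀ x, g x ≤ M := fun x => by
    by_cases hx : x ∈ Set.Icc (-M) M
    · rw [hg, Set.indicator_of_mem hx]; exact abs_le.2 hx
    · rw [hg, Set.indicator_of_notMem hx]; exact hM0.le
  have hgi : ∀ p, Integrable (fun ω => g (Z p ω)) μ := fun p =>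
    Integrable.of_bound (hgm.comp_aemeasurable (hZ p).aemeasurable).aestronglyMeasurable M
      (Filter.Eventually.of_forall fun ω => by
        rw [Real.norm_eq_abs, abs_of_nonneg (hg0 _)]; exact hgM _)
  have hge : ∀ p, ∫ ω, g (Z p ω) ∂μ = L / Real.pi := fun p => by
    have := (hZ p).integral_comp (f := g) hgm.aestronglyMeasurable
    simp only [Function.comp_def] at this
    rw [this, hg, integral_indicator measurableSet_Icc, setIntegral_abs_cauchyMeasure hM0.le]
  have hsub : {ω | 20 * m * L < ∑ p, |Z p ω|} ⊆
      (⋃ p, {ω | Z p ω ∈ (Set.Icc (-M) M)ᶜ}) ∪ {ω | 20 * m * L ≤ ∑ p, g (Z p ω)} := by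
    intro ω hω
    by_cases h : ∃ p, Z p ω ∈ (Set.Icc (-M) M)ᶜ
    · exact Or.inl (Set.mem_iUnion.2 h)
    · right
      push Not at h
      have : ∑ p, g (Z p ω) = ∑ p, |Z p ω| := Finset.sum_congr rfl fun p _ => by
        rw [hg, Set.indicator_of_mem (not_not.1 (h p))]
      simp only [Set.mem_ofPred_eq] at hω ⊢
      rw [this]; exact hω.le
  have h1 : μ.real (⋃ p, {ω | Z p ω ∈ (Set.Icc (-M) M)ᶜ}) ≤ 1 / 40 := by
    calc _ ≤ ∑ p, μ.real {ω | Z p ω ∈ (Set.Icc (-M) M)ᶜ} := measureReal_iUnion_fintype_le _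
      _ ≤ ∑ _p : ι, 1 / M := Finset.sum_le_sum fun p _ => by
          rw [(hZ p).measureReal_eq (p := fun x => x ∈ (Set.Icc (-M) M)ᶜ) measurableSet_Icc.compl]
          exact cauchyMeasure_real_compl_Icc_le hM0
      _ = Fintype.card ι * (1 / M) := by simp
      _ ≤ m * (1 / M) := by gcongr
      _ = 1 / 40 := by rw [hM]; field_simp
  have h2 : μ.real {ω | 20 * m * L ≤ ∑ p, g (Z p ω)} ≤ 1 / 40 := by
    have hB : 0 < 20 * m * L := by positivity
    have hmk := mul_meas_ge_le_integral_of_nonneg (μ := μ) (f := fun ω => ∑ p, g (Z p ω))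
      (Filter.Eventually.of_forall fun ω => Finset.sum_nonneg fun p _ => hg0 _)
      (integrable_finsetSum _ fun p _ => hgi p) (20 * m * L)
    rw [integral_finsetSum _ fun p _ => hgi p] at hmk
    simp only [hge, Finset.sum_const, Finset.card_univ, nsmul_eq_mul] at hmk
    have h3 : Fintype.card ι * (L / Real.pi) ≤ m * (L / 2) := by
      have := Real.pi_gt_three
      gcongr
      linarith
    have h4 : μ.real {ω | 20 * m * L ≤ ∑ p, g (Z p ω)} * (20 * m * L) ≤ 1 / 40 * (20 * m * L) := by
      rw [mul_comm]
      exact (hmk.trans h3).trans (by linarith)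
    exact le_of_mul_le_mul_right h4 hB
  calc _ ≤ _ := measureReal_mono hsub
    _ ≤ _ := measureReal_union_le _ _
    _ ≤ 1 / 40 + 1 / 40 := add_le_add h1 h2
    _ = 1 / 20 := by norm_num

end Stability

/-! ### Auerbach bases and well-conditioned bases for `ℓ₁`. -/

section Auerbach

open Module

/-- **Auerbach's lemma**. -/
theorem exists_auerbach_basis (E : Type*) [NormedAddCommGroup E] [NormedSpace ℝ E]
    [FiniteDimensional ℝ E] :
    ∃ b : Basis (Fin (finrank ℝ E)) ℝ E, (∀ i, ‖b i‖ = 1) ∧ ∀ x i, |b.repr x i| ≤ ‖x‖ := by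
  have := FiniteDimensional.proper ℝ E
  set e := finBasis ℝ E
  have hcont : Continuous fun v : Fin (finrank ℝ E) → E => |e.det v| := by
    refine continuous_abs.comp (Continuous.matrix_det (continuous_matrix fun i j => ?_))
    exact (e.coord i).continuous_of_finiteDimensional.comp (continuous_apply j)
  -- The basis is a maximiser of `|det|` over tuples in the unit ball.
  obtain ⟨v, hv, hmax⟩ :=
    (isCompact_univ_pi fun _ : Fin (finrank ℝ E) => isCompact_closedBall (0 : E) 1).exists_isMaxOn
      ⟨fun _ => 0, fun _ _ => by simp⟩ hcont.continuousOn
  have hpos : 0 < |e.det v| := by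
    refine lt_of_lt_of_le ?_ (hmax (a := fun i => ‖e i‖⁻¹ • e i) fun i _ => ?_)
    · rw [abs_pos, show e.det (fun i => ‖e i‖⁻¹ • e i) = (∏ i, ‖e i‖⁻¹) • e.det e from
        e.det.toMultilinearMap.map_smul_univ _ _, e.det_self]
      simp [Finset.prod_ne_zero_iff, e.ne_zero]
    · simp [norm_smul, e.ne_zero]
  obtain ⟨hli, hsp⟩ := e.is_basis_iff_det.2 (abs_pos.1 hpos).isUnit
  set b := Basis.mk hli hsp.ge with hb
  have hbv : ∀ i, b i = v i := fun i => by rw [hb, Basis.mk_apply]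
  -- Cramer's rule: the `i`-th coordinate of `x` is the ratio by which the determinant changes when
  -- `v i` is replaced by `x`; maximality bounds it by 1.
  have hball : ∀ x : E, ‖x‖ ≤ 1 → ∀ i, |b.repr x i| ≤ 1 := by
    intro x hx i
    have h := LinearMap.congr_fun (e.det_smul_mk_coord_eq_det_update hli hsp.ge i) x
    have h2 : |e.det (Function.update v i x)| ≤ |e.det v| := by
      refine hmax fun j _ => ?_
      rcases eq_or_ne j i with rfl | hj
      · simpa using hx
      · rw [Function.update_of_ne hj]; exact hv j (Set.mem_univ _)
    have h3 : e.det v * b.repr x i = e.det (Function.update v i x) := h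
    rw [← h3, abs_mul] at h2
    exact le_of_mul_le_mul_left (by simpa using h2) hpos
  have hcoord : ∀ x i, |b.repr x i| ≤ ‖x‖ := by
    intro x i
    rcases eq_or_ne x 0 with rfl | hx
    · simp
    have hx' : 0 < ‖x‖ := norm_pos_iff.2 hx
    have := hball (‖x‖⁻¹ • x) (by simp [norm_smul, hx]) i
    rw [map_smul, Finsupp.smul_apply, smul_eq_mul, abs_mul, abs_of_pos (by positivity),
      inv_mul_le_iff₀ hx'] at this
    simpa using this
  refine ⟨b, fun i => le_antisymm ?_ ?_, hcoord⟩
  · rw [hbv]; simpa using hv i (Set.mem_univ _)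
  · simpa using hcoord (b i) i

theorem exists_l1Norm_wellConditioned_basis {n d : ℕ} (A : Matrix (Fin n) (Fin d) ℝ) :
    ∃ k ≤ d, ∃ U : Matrix (Fin n) (Fin k) ℝ, (∀ j, l1Norm (U.col j) = 1) ∧
      (∀ a j, |a j| ≤ l1Norm (U *ᵥ a)) ∧ ∀ x, ∃ a, A *ᵥ x = U *ᵥ a := by
  set f : (Fin d → ℝ) →ₗ[ℝ] PiLp 1 fun _ : Fin n => ℝ :=
    (WithLp.linearEquiv 1 ℝ (Fin n → ℝ)).symm.toLinearMap ∘ₗ A.mulVecLin with hf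
  obtain ⟨b, hb, hcoord⟩ := exists_auerbach_basis (LinearMap.range f)
  have hk : finrank ℝ (LinearMap.range f) ≤ d := by
    simpa using LinearMap.finrank_range_le f
  set U : Matrix (Fin n) (Fin (finrank ℝ (LinearMap.range f))) ℝ :=
    Matrix.of fun l j => (b j : PiLp 1 fun _ : Fin n => ℝ) l with hU
  have hUa : ∀ a, WithLp.toLp 1 (U *ᵥ a) = ((∑ j, a j • b j : LinearMap.range f) :
      PiLp 1 fun _ : Fin n => ℝ) := by
    intro a
    ext l
    simp [hU, Matrix.mulVec, dotProduct, mul_comm]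
  refine ⟨_, hk, U, fun j => ?_, fun a j => ?_, fun x => ?_⟩
  · rw [← hb j]; rfl
  · have := hcoord (∑ j, a j • b j) j
    rw [b.repr_sum_self] at this
    rw [l1Norm, hUa]
    exact this
  · refine ⟨b.repr ⟨f x, x, rfl⟩, WithLp.toLp_injective 1 ?_⟩
    rw [hUa, b.sum_repr]
    rfl

end Auerbach

/-! ### From an integer grid to all vectors. -/

section Net

variable {n r k : ℕ}

theorem l1Norm_nonneg (v : Fin n → ℝ) : 0 ≤ l1Norm v := norm_nonneg _

theorem l1Norm_smul (t : ℝ) (v : Fin n → ℝ) : l1Norm (t • v) = |t| * l1Norm v := by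
  rw [l1Norm, WithLp.toLp_smul, norm_smul, Real.norm_eq_abs, l1Norm]

theorem l1Norm_sub_le (v w : Fin n → ℝ) : l1Norm v - l1Norm w ≤ l1Norm (v - w) := by
  rw [l1Norm, l1Norm, l1Norm, WithLp.toLp_sub]
  exact norm_sub_norm_le _ _

theorem l1Norm_mulVec_le (M : Matrix (Fin r) (Fin k) ℝ) {a : Fin k → ℝ} {t : ℝ}
    (ha : ∀ j, |a j| ≤ t) : l1Norm (M *ᵥ a) ≤ (∑ p : Fin r × Fin k, |M p.1 p.2|) * t := by
  rw [l1Norm_eq_sum, Fintype.sum_prod_type, Finset.sum_mul]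
  refine Finset.sum_le_sum fun i _ => ?_
  rw [Matrix.mulVec, dotProduct, Finset.sum_mul]
  refine (Finset.abs_sum_le_sum_abs _ _).trans (Finset.sum_le_sum fun j _ => ?_)
  rw [abs_mul]
  exact mul_le_mul_of_nonneg_left (ha j) (abs_nonneg _)

theorem sum_abs_eq_of_l1Norm_col {U : Matrix (Fin n) (Fin k) ℝ}
    (hU : ∀ j, l1Norm (U.col j) = 1) : ∑ p : Fin n × Fin k, |U p.1 p.2| = k := by
  rw [Fintype.sum_prod_type_right]
  simp only [l1Norm_eq_sum, Matrix.col_apply] at hU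
  simp [hU]

/-- Integer vectors with entries in `{-N, …, N}`. -/
noncomputable def intGrid (k N : ℕ) : Finset (Fin k → ℤ) :=
  Fintype.piFinset fun _ => Finset.Icc (-(N : ℤ)) N

theorem card_intGrid (k N : ℕ) : (intGrid k N).card = (2 * N + 1) ^ k := by
  rw [intGrid, Fintype.card_piFinset]
  simp only [Int.card_Icc, Finset.prod_const, Finset.card_univ, Fintype.card_fin]
  congr 1; omega

/-- Rounding coordinates down moves `U a` by at most `k` and `S U a` by at most `B`. At norm `N`,
`hN` makes the total loss at most `(1/20) r N`, the gap between 3/10 and 1/4. -/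
theorem le_l1Norm_mulVec_of_intGrid {U : Matrix (Fin n) (Fin k) ℝ} {S : Matrix (Fin r) (Fin n) ℝ}
    (hU : ∀ j, l1Norm (U.col j) = 1) (hcoord : ∀ a j, |a j| ≤ l1Norm (U *ᵥ a)) {B : ℝ} {N : ℕ}
    (hN : 3 / 10 * r * k + B ≤ 1 / 20 * r * N) (hN0 : 0 < N)
    (hB : ∑ p : Fin r × Fin k, |(S * U) p.1 p.2| ≤ B)
    (hgrid : ∀ z ∈ intGrid k N, 3 / 10 * r * l1Norm (U *ᵥ fun j => (z j : ℝ))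
      ≤ l1Norm (S *ᵥ (U *ᵥ fun j => (z j : ℝ)))) (a : Fin k → ℝ) :
    1 / 4 * r * l1Norm (U *ᵥ a) ≤ l1Norm (S *ᵥ (U *ᵥ a)) := by
  rcases eq_or_ne (l1Norm (U *ᵥ a)) 0 with h0 | h0
  · rw [h0, mul_zero]; exact l1Norm_nonneg _
  have hpos : 0 < l1Norm (U *ᵥ a) := lt_of_le_of_ne (l1Norm_nonneg _) h0.symm
  -- Rescaling to norm exactly `N` puts all coordinates in `[-N, N]`, by `hcoord`, so the rounded
  -- vector lies in the grid.
  set s : ℝ := N / l1Norm (U *ᵥ a) with hs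
  have hs0 : 0 < s := by positivity
  set a' : Fin k → ℝ := s • a with ha'
  have hnorm : l1Norm (U *ᵥ a') = N := by
    rw [ha', Matrix.mulVec_smul, l1Norm_smul, abs_of_pos hs0, hs]; field_simp
  have hnormS : l1Norm (S *ᵥ (U *ᵥ a')) = s * l1Norm (S *ᵥ (U *ᵥ a)) := by
    rw [ha', Matrix.mulVec_smul, Matrix.mulVec_smul, l1Norm_smul, abs_of_pos hs0]
  set z : Fin k → ℤ := fun j => ⌊a' j⌋ with hz
  set zr : Fin k → ℝ := fun j => (z j : ℝ) with hzr
  have hzmem : z ∈ intGrid k N := by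
    rw [intGrid, Fintype.mem_piFinset]
    intro j
    have h := abs_le.1 ((hcoord a' j).trans hnorm.le)
    rw [Finset.mem_Icc]
    refine ⟨Int.le_floor.2 (by push_cast; exact h.1), ?_⟩
    have : (⌊a' j⌋ : ℝ) ≤ N := (Int.floor_le _).trans h.2
    exact_mod_cast this
  have hdiff : ∀ j, |(a' - zr) j| ≤ 1 := fun j => by
    have h1 := Int.floor_le (a' j)
    have h2 := Int.lt_floor_add_one (a' j)
    rw [Pi.sub_apply, abs_le]
    constructor <;> simp only [hzr, hz] <;> linarith
  have hUd : l1Norm (U *ᵥ (a' - zr)) ≤ k := by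
    have := l1Norm_mulVec_le U hdiff
    rwa [sum_abs_eq_of_l1Norm_col hU, mul_one] at this
  have hSUd : l1Norm (S *ᵥ (U *ᵥ (a' - zr))) ≤ B := by
    rw [Matrix.mulVec_mulVec]
    have := l1Norm_mulVec_le (S * U) hdiff
    rw [mul_one] at this
    exact this.trans hB
  have h1 : (N : ℝ) - l1Norm (U *ᵥ zr) ≤ k := by
    rw [← hnorm]
    refine (l1Norm_sub_le _ _).trans ?_
    rwa [← Matrix.mulVec_sub]
  have h2 : l1Norm (S *ᵥ (U *ᵥ zr)) - l1Norm (S *ᵥ (U *ᵥ a')) ≤ B := by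
    have hneg : S *ᵥ (U *ᵥ zr) - S *ᵥ (U *ᵥ a') = (-1 : ℝ) • (S *ᵥ (U *ᵥ (a' - zr))) := by
      rw [Matrix.mulVec_sub, Matrix.mulVec_sub]; simp
    refine (l1Norm_sub_le _ _).trans ?_
    rw [hneg, l1Norm_smul]
    simpa using hSUd
  have h3 := hgrid z hzmem
  have h4 : 3 / 10 * r * ((N : ℝ) - k) ≤ 3 / 10 * r * l1Norm (U *ᵥ zr) :=
    mul_le_mul_of_nonneg_left (by linarith) (by positivity)
  have h5 : 1 / 4 * r * (N : ℝ) ≤ s * l1Norm (S *ᵥ (U *ᵥ a)) := by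
    rw [← hnormS]
    have : l1Norm (S *ᵥ (U *ᵥ zr)) = l1Norm (S *ᵥ (U *ᵥ fun j => (z j : ℝ))) := rfl
    linarith
  have h6 : (N : ℝ) = s * l1Norm (U *ᵥ a) := by rw [hs]; field_simp
  rw [h6] at h5
  refine le_of_mul_le_mul_left ?_ hs0
  linarith

end Net

/-! ### Probability of the two-sided bound. -/

theorem IsCauchyMatrix.le_measure_distortion {Ω : Type*} [MeasurableSpace Ω] {μ : Measure Ω}
    [IsProbabilityMeasure μ] {r n d : ℕ} {S : Ω → Matrix (Fin r) (Fin n) ℝ}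
    (hS : IsCauchyMatrix μ S) (A : Matrix (Fin n) (Fin d) ℝ) {N : ℕ} {B : ℝ}
    (hrd : (1 : ℝ) ≤ r * d) (hBeq : B = 20 * (r * d) * Real.log (1 + (40 * (r * d)) ^ 2))
    (hN0 : 0 < N) (hN : 3 / 10 * r * d + B ≤ 1 / 20 * r * N)
    (hexp : ((2 * N + 1) ^ d : ℝ) * Real.exp (-(r / 20)) ≤ 1 / 20) :
    (9 / 10 : ℝ≥0∞) ≤ μ {ω | ∀ x, 1 / 4 * r * l1Norm (A *ᵥ x) ≤ l1Norm ((S ω * A) *ᵥ x) ∧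
      l1Norm ((S ω * A) *ᵥ x) ≤ B * l1Norm (A *ᵥ x)} := by
  obtain ⟨k, hk, U, hU, hcoord, hA⟩ := exists_l1Norm_wellConditioned_basis A
  have hkd : (k : ℝ) ≤ d := by exact_mod_cast hk
  set G := {ω | ∀ x, 1 / 4 * r * l1Norm (A *ᵥ x) ≤ l1Norm ((S ω * A) *ᵥ x) ∧
      l1Norm ((S ω * A) *ᵥ x) ≤ B * l1Norm (A *ᵥ x)} with hG
  set E₁ := {ω | B < ∑ p : Fin r × Fin k, |(S ω * U) p.1 p.2|} with hE₁
  set E₂ := ⋃ z : intGrid k N, {ω | l1Norm (S ω *ᵥ (U *ᵥ fun j => ((z : Fin k → ℤ) j : ℝ)))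
      < 3 / 10 * r * l1Norm (U *ᵥ fun j => ((z : Fin k → ℤ) j : ℝ))} with hE₂
  have h₁ : μ.real E₁ ≤ 1 / 20 := by
    rw [hE₁, hBeq]
    refine measureReal_sum_abs_cauchy_gt_le (ι := Fin r × Fin k)
      (Z := fun p ω => (S ω * U) p.1 p.2) (fun p => hS.hasLaw_mulVec (hU p.2) p.1) hrd ?_
    rw [Fintype.card_prod, Fintype.card_fin, Fintype.card_fin]
    push_cast
    gcongr
  have h₂ : μ.real E₂ ≤ 1 / 20 := by
    calc μ.real E₂ ≤ ∑ z : intGrid k N, _ := measureReal_iUnion_fintype_le _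
      _ ≤ ∑ _z : intGrid k N, Real.exp (-(r / 20)) :=
        Finset.sum_le_sum fun z _ => hS.measureReal_l1Norm_mulVec_lt_le _
      _ = ((2 * N + 1) ^ k : ℝ) * Real.exp (-(r / 20)) := by
        rw [Finset.sum_const, Finset.card_univ, Fintype.card_coe, card_intGrid, nsmul_eq_mul]
        push_cast; rfl
      _ ≤ ((2 * N + 1) ^ d : ℝ) * Real.exp (-(r / 20)) := by
        gcongr
        have : (0 : ℝ) ≤ N := Nat.cast_nonneg N
        linarith
      _ ≤ 1 / 20 := hexp
  have hcompl : Gᶜ ⊆ E₁ ∪ E₂ := by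
    intro ω hω
    by_contra hne
    rw [Set.mem_union, not_or] at hne
    refine hω fun x => ?_
    have hB : ∑ p : Fin r × Fin k, |(S ω * U) p.1 p.2| ≤ B := not_lt.1 hne.1
    have hgrid : ∀ z ∈ intGrid k N, 3 / 10 * r * l1Norm (U *ᵥ fun j => (z j : ℝ))
        ≤ l1Norm (S ω *ᵥ (U *ᵥ fun j => (z j : ℝ))) := fun z hz => by
      by_contra hlt
      exact hne.2 (Set.mem_iUnion.2 ⟨⟨z, hz⟩, not_le.1 hlt⟩)
    obtain ⟨a, ha⟩ := hA x
    rw [← Matrix.mulVec_mulVec, ha]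
    refine ⟨le_l1Norm_mulVec_of_intGrid hU hcoord (le_trans ?_ hN) hN0 hB hgrid a, ?_⟩
    · gcongr
    · rw [Matrix.mulVec_mulVec]
      refine (l1Norm_mulVec_le (S ω * U) (hcoord a)).trans ?_
      exact mul_le_mul_of_nonneg_right hB (l1Norm_nonneg _)
  have hbad : μ.real Gᶜ ≤ 1 / 10 := by
    calc μ.real Gᶜ ≤ μ.real (E₁ ∪ E₂) := measureReal_mono hcompl
      _ ≤ μ.real E₁ + μ.real E₂ := measureReal_union_le _ _
      _ ≤ 1 / 20 + 1 / 20 := add_le_add h₁ h₂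
      _ = 1 / 10 := by norm_num
  -- Subadditivity suffices here and needs no measurability of `G`.
  have htot : 1 ≤ μ.real G + μ.real Gᶜ := by
    have := measureReal_union_le (μ := μ) G Gᶜ
    rwa [Set.union_compl_self, probReal_univ] at this
  have hgood : 9 / 10 ≤ μ.real G := by linarith
  have h910 : (9 / 10 : ℝ≥0∞) = ENNReal.ofReal (9 / 10) := by
    rw [ENNReal.ofReal_div_of_pos (by norm_num)]; simp
  rw [h910]
  exact ENNReal.ofReal_le_of_le_toReal hgood

/-! ### Numerical estimates for the constants. -/

section Numerics

theorem log_ge_half {d : ℕ} (hd : 2 ≤ d) : 1 / 2 ≤ Real.log d := by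
  have h1 : Real.log 2 ≤ Real.log d := Real.log_le_log (by norm_num) (by exact_mod_cast hd)
  have := Real.log_two_gt_d9
  linarith

theorem mul_log_le_rpow {K : ℝ} (hK : 0 < K) {d : ℕ} (hd : 2 ≤ d) :
    K * (d * Real.log d) ≤ (d : ℝ) ^ (|Real.log K| / Real.log 2 + 2) := by
  have hd0 : (0 : ℝ) < d := by positivity
  have h2 : 0 < Real.log 2 := Real.log_pos (by norm_num)
  have hlog : Real.log 2 ≤ Real.log d := Real.log_le_log (by norm_num) (by exact_mod_cast hd)
  -- Since `d ≥ 2`, a constant is absorbed into a power of `d`.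
  have hK' : K ≤ (d : ℝ) ^ (|Real.log K| / Real.log 2) := by
    rw [Real.rpow_def_of_pos hd0, ← Real.log_le_iff_le_exp hK]
    calc Real.log K ≤ |Real.log K| := le_abs_self _
      _ = Real.log 2 * (|Real.log K| / Real.log 2) := by field_simp
      _ ≤ Real.log d * (|Real.log K| / Real.log 2) := by gcongr
  have hle : Real.log d ≤ d := (Real.log_le_sub_one_of_pos hd0).trans (by linarith)
  rw [Real.rpow_add hd0, Real.rpow_two]
  have : (d : ℝ) * Real.log d ≤ d ^ 2 := by rw [sq]; gcongr
  exact mul_le_mul hK' this (mul_nonneg hd0.le (by linarith)) (by positivity)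

variable {d r : ℕ}

theorem two_mul_add_one_pow_mul_exp_le (hd : 2 ≤ d)
    (hr : 10000 * (d * Real.log d) ≤ (r : ℝ)) (hr1 : (1000 : ℝ) ≤ r) :
    ((2 * (32006 * r ^ 3 : ℕ) + 1) ^ d : ℝ) * Real.exp (-(r / 20)) ≤ 1 / 20 := by
  have hd0 : (0 : ℝ) < d := by positivity
  have hr0 : (0 : ℝ) < r := by linarith
  have hlog : Real.log 2 ≤ Real.log d := Real.log_le_log (by norm_num) (by exact_mod_cast hd)
  -- From `log u ≤ u - 1` at `u = r / (1024 d)`: `d log r` is thus `O(d log d)` plus a small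
  -- multiple of `r`.
  have hs : Real.log r ≤ Real.log d + 10 * Real.log 2 + r / d / 1024 := by
    have h1 := Real.log_le_sub_one_of_pos (show (0 : ℝ) < r / d / 1024 by positivity)
    rw [Real.log_div (by positivity) (by norm_num), Real.log_div hr0.ne' hd0.ne',
      show (1024 : ℝ) = 2 ^ 10 by norm_num, Real.log_pow] at h1
    push_cast at h1
    norm_num at h1 ⊢
    linarith
  have hbase : (2 * (32006 * r ^ 3 : ℕ) + 1 : ℝ) ≤ Real.exp (16 * Real.log 2 + 3 * Real.log r) := by
    have h2 : Real.exp (16 * Real.log 2 + 3 * Real.log r) = 2 ^ 16 * (r : ℝ) ^ 3 := by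
      rw [Real.exp_add, mul_comm 16, mul_comm 3, Real.exp_mul, Real.exp_mul, Real.exp_log two_pos,
        Real.exp_log hr0]
      norm_cast
    rw [h2]
    push_cast
    have : (1 : ℝ) ≤ (r : ℝ) ^ 3 := one_le_pow₀ (by linarith)
    linarith
  have hd_s : d * Real.log r ≤ 11 * (d * Real.log d) + r / 1024 := by
    calc d * Real.log r ≤ d * (Real.log d + 10 * Real.log d + r / d / 1024) := by
          gcongr; linarith
      _ = _ := by field_simp; ring
  have hdl : d * Real.log 2 ≤ d * Real.log d := by gcongr
  have hexp : d * (16 * Real.log 2 + 3 * Real.log r) ≤ r / 100 := by linarith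
  have hfin : Real.exp (-(r / 25)) ≤ 1 / 20 := by
    rw [Real.exp_neg, one_div]
    refine inv_anti₀ (by norm_num) ?_
    have := Real.add_one_le_exp ((r : ℝ) / 25)
    linarith
  calc _ ≤ Real.exp (16 * Real.log 2 + 3 * Real.log r) ^ d * Real.exp (-(r / 20)) := by gcongr
    _ = Real.exp (d * (16 * Real.log 2 + 3 * Real.log r) + -(r / 20)) := by
      rw [← Real.exp_nat_mul, Real.exp_add]
    _ ≤ Real.exp (-(r / 25)) := Real.exp_le_exp.2 (by linarith)
    _ ≤ _ := hfin

theorem log_one_add_sq_le {y : ℝ} (hy : 0 ≤ y) : Real.log (1 + y ^ 2) ≤ 2 * y := by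
  calc Real.log (1 + y ^ 2) ≤ Real.log ((1 + y) ^ 2) :=
        Real.log_le_log (by positivity) (by nlinarith)
    _ = 2 * Real.log (1 + y) := by rw [Real.log_pow]; norm_num
    _ ≤ 2 * y := by
      have := Real.log_le_sub_one_of_pos (show 0 < 1 + y by positivity)
      linarith

/-- The upper bound on `r` gives `r d ≤ C d ^ 3`, hence `log (r d) = O(log d)`; this keeps the
distortion at `O(d log d)`. -/
theorem log_one_add_mul_sq_le {C : ℝ} (hd : 2 ≤ d)
    (hr : (r : ℝ) ≤ C * (d * Real.log d)) :
    Real.log (1 + (40 * (r * d)) ^ 2)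
      ≤ (6 + Real.log (1 + 1600 * C ^ 2) / Real.log 2) * Real.log d := by
  have hd1 : (1 : ℝ) ≤ d := by exact_mod_cast (by omega : 1 ≤ d)
  have hd0 : (0 : ℝ) < d := by linarith
  have h2 : 0 < Real.log 2 := Real.log_pos (by norm_num)
  have hlog : Real.log 2 ≤ Real.log d := Real.log_le_log (by norm_num) (by exact_mod_cast hd)
  have hle : Real.log d ≤ d := (Real.log_le_sub_one_of_pos hd0).trans (by linarith)
  have hC : 0 ≤ C := by
    by_contra hC
    have : C * (d * Real.log d) < 0 :=
      mul_neg_of_neg_of_pos (not_le.1 hC) (mul_pos hd0 (by linarith))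
    have := Nat.cast_nonneg (α := ℝ) r
    linarith
  have h3 : (r : ℝ) * d ≤ C * d ^ 3 := by
    calc (r : ℝ) * d ≤ C * (d * d) * d := by gcongr; exact hr.trans (by gcongr)
      _ = _ := by ring
  have h4 : 1 + (40 * (r * d : ℝ)) ^ 2 ≤ (d : ℝ) ^ 6 * (1 + 1600 * C ^ 2) := by
    have h5 : (r * d : ℝ) ^ 2 ≤ (C * d ^ 3) ^ 2 := by gcongr
    have h6 : (1 : ℝ) ≤ (d : ℝ) ^ 6 := one_le_pow₀ hd1
    calc 1 + (40 * (r * d : ℝ)) ^ 2 = 1 + 1600 * (r * d : ℝ) ^ 2 := by ring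
      _ ≤ (d : ℝ) ^ 6 + 1600 * (C * d ^ 3) ^ 2 := by gcongr
      _ = _ := by ring
  have h7 : 0 ≤ Real.log (1 + 1600 * C ^ 2) := Real.log_nonneg (by nlinarith)
  calc _ ≤ Real.log ((d : ℝ) ^ 6 * (1 + 1600 * C ^ 2)) := Real.log_le_log (by positivity) h4
    _ = 6 * Real.log d + Real.log (1 + 1600 * C ^ 2) := by
      rw [Real.log_mul (by positivity) (by positivity), Real.log_pow]; norm_num
    _ = 6 * Real.log d + Real.log (1 + 1600 * C ^ 2) / Real.log 2 * Real.log 2 := by field_simp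
    _ ≤ 6 * Real.log d + Real.log (1 + 1600 * C ^ 2) / Real.log 2 * Real.log d := by gcongr
    _ = _ := by ring

end Numerics

/-! ### The theorem: choice of constants and assembly. -/

theorem mainTheorem6 :
    ∃ c : ℝ, 0 < c ∧ ∀ C : ℝ, c ≤ C →
      ∃ K c₁ c₂ : ℝ, 0 < K ∧ 0 < c₁ ∧ 0 < c₂ ∧
        ∀ (d n r : ℕ), 2 ≤ d →
          c * ((d : ℝ) * Real.log d) ≤ (r : ℝ) →
          (r : ℝ) ≤ C * ((d : ℝ) * Real.log d) →
        ∀ (A : Matrix (Fin n) (Fin d) ℝ)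
          {Ω : Type*} [MeasurableSpace Ω] (μ : Measure Ω) [IsProbabilityMeasure μ]
          (S : Ω → Matrix (Fin r) (Fin n) ℝ), IsCauchyMatrix μ S →
          (9 / 10 : ℝ≥0∞) ≤ μ {ω |
            IsL1SubspaceEmbedding c₁ c₂ ((4 / (r : ℝ)) • S ω) A ∧
            ∀ x : Fin d → ℝ,
              l1Norm (A *ᵥ x) ≤ 4 * l1Norm ((S ω * A) *ᵥ x) / (r : ℝ) ∧
              4 * l1Norm ((S ω * A) *ᵥ x) / (r : ℝ)
                ≤ K * ((d : ℝ) * Real.log d) * l1Norm (A *ᵥ x)} := by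
  refine ⟨10000, by norm_num, fun C hC => ?_⟩
  have h2 : 0 < Real.log 2 := Real.log_pos (by norm_num)
  have hC0 : 0 < C := by linarith
  have hlogC : 0 ≤ Real.log (1 + 1600 * C ^ 2) := Real.log_nonneg (by nlinarith)
  -- Here `80 = 4 * 20`: the rescaling by `4 / r` times the 20 in `B`.
  set K : ℝ := 80 * (6 + Real.log (1 + 1600 * C ^ 2) / Real.log 2) with hK
  have hK0 : 0 < K := by positivity
  refine ⟨K, |Real.log K| / Real.log 2 + 2, |Real.log C| / Real.log 2 + 2, hK0, by positivity,
    by positivity, fun d n r hd hr hrC A Ω _ μ _ S hS => ?_⟩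
  have hlogd := log_ge_half hd
  have hd2 : (2 : ℝ) ≤ d := by exact_mod_cast hd
  have hdl : (d : ℝ) * (1 / 2) ≤ d * Real.log d := by gcongr
  have hdr : (d : ℝ) ≤ r := by linarith
  have hr1 : (1000 : ℝ) ≤ r := by linarith
  have hr0 : (0 : ℝ) < r := by linarith
  have hrd : (1 : ℝ) ≤ r * d := by nlinarith
  set B : ℝ := 20 * (r * d) * Real.log (1 + (40 * (r * d)) ^ 2) with hB
  -- The crude bound `log (1 + y ^ 2) ≤ 2 y` is enough, since the grid size matters only through its
  -- logarithm; `32006 = 6 + 32000` collects the two terms.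
  have hN : 3 / 10 * r * d + B ≤ 1 / 20 * r * (32006 * r ^ 3 : ℕ) := by
    have h3 : B ≤ 20 * (r * d) * (2 * (40 * (r * d))) := by
      rw [hB]; gcongr; exact log_one_add_sq_le (by positivity)
    have h4 : (d : ℝ) ≤ r ^ 3 := hdr.trans (le_self_pow₀ (by linarith) (by norm_num))
    have h5 : (r * d ^ 2 : ℝ) ≤ r ^ 3 := by
      calc (r * d ^ 2 : ℝ) ≤ r * r ^ 2 := by gcongr
        _ = _ := by ring
    push_cast
    calc 3 / 10 * r * d + B ≤ 1 / 20 * r * (6 * d + 32000 * (r * d ^ 2)) := by linarith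
      _ ≤ 1 / 20 * r * (6 * r ^ 3 + 32000 * r ^ 3) := by gcongr
      _ = _ := by ring
  have hrnat : 0 < r := by exact_mod_cast hr0
  refine (hS.le_measure_distortion A hrd hB (by positivity) hN
    (two_mul_add_one_pow_mul_exp_le hd hr hr1)).trans (measure_mono fun ω hω => ?_)
  have hBK : 4 * B / r ≤ K * (d * Real.log d) := by
    have h3 := log_one_add_mul_sq_le hd hrC
    calc 4 * B / r = 80 * d * Real.log (1 + (40 * (r * d)) ^ 2) := by rw [hB]; field_simp; ring
      _ ≤ 80 * d * ((6 + Real.log (1 + 1600 * C ^ 2) / Real.log 2) * Real.log d) := by gcongr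
      _ = _ := by rw [hK]; ring
  have hmain : ∀ x : Fin d → ℝ, l1Norm (A *ᵥ x) ≤ 4 * l1Norm ((S ω * A) *ᵥ x) / (r : ℝ) ∧
      4 * l1Norm ((S ω * A) *ᵥ x) / (r : ℝ) ≤ K * ((d : ℝ) * Real.log d) * l1Norm (A *ᵥ x) := by
    intro x
    obtain ⟨hlo, hhi⟩ := hω x
    constructor
    · rw [le_div_iff₀ hr0]; linarith
    · calc 4 * l1Norm ((S ω * A) *ᵥ x) / (r : ℝ) ≤ 4 * (B * l1Norm (A *ᵥ x)) / r := by gcongr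
        _ = 4 * B / r * l1Norm (A *ᵥ x) := by ring
        _ ≤ _ := mul_le_mul_of_nonneg_right hBK (l1Norm_nonneg _)
  refine ⟨⟨fun x => ?_, hrC.trans (mul_log_le_rpow hC0 hd)⟩, hmain⟩
  have hscale : l1Norm (((4 / (r : ℝ)) • S ω * A) *ᵥ x) = 4 * l1Norm ((S ω * A) *ᵥ x) / r := by
    rw [Matrix.smul_mul, Matrix.smul_mulVec, l1Norm_smul, abs_of_pos (by positivity)]
    ring
  rw [hscale]
  exact ⟨(hmain x).1, (hmain x).2.trans
    (mul_le_mul_of_nonneg_right (mul_log_le_rpow hK0 hd) (l1Norm_nonneg _))⟩
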